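/- Consider a battery with energy capacity $E>0$, charge and discharge efficiencies $\eta^{ch},\eta^{dis}>0$, power ratings $D,G$ and dispatch interval length $M>0$. Let $T\in\mathbb{N}$, and let $d_t$ and $g_t$ ($t=1,\dots,T$) be the charge and discharge powers of a dispatch with initial stored energy $e_0$ and stored energy $e_t=e_{t-1}+M(d_t\eta^{ch}-g_t/\eta^{dis})$. Assume that the dispatch is feasible: for each $t$ there is a mode $v_t\in\{0,1\}$ with $0\le d_t\le D(1-v_t)$ and $0\le g_t\le Gv_t$, and $0\le e_t\le E$ for $t=0,\dots,T$. Let $\Phi:[0,1]\to\mathbb{R}$ be a convex cycle depth stress function with $\Phi(0)=0$, and let $R$ be the cell replacement cost. Segment model. For $J\ge 1$ put $c_j=\frac{R}{\eta^{dis}E}\,J\,[\Phi(j/J)-\Phi((j-1)/J)]$ and $\bar e=E/J$ for $j=1,\dots,J$. Define, in the order of increasing $t$ and, for each $t$, of increasing $j$, $$\hat e_{0,j}=\min\Big[\bar e,\max\big(0,e_0-\sum_{\zeta<j}\hat e_{0,\zeta}\big)\Big],$$ $$\hat p^{ch}_{t,j}=\min\Big[d_t-\sum_{\zeta<j}\hat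 p^{ch}_{t,\zeta},\ \frac{\bar e-\hat e_{t-1,j}}{\eta^{ch}M}\Big],\qquad \hat p^{dis}_{t,j}=\min\Big[g_t-\sum_{\zeta<j}\hat p^{dis}_{t,\zeta},\ \frac{\eta^{dis}\hat e_{t-1,j}}{M}\Big],$$ $$\hat e_{t,j}=\hat e_{t-1,j}+M(\hat p^{ch}_{t,j}\eta^{ch}-\hat p^{dis}_{t,j}/\eta^{dis}),$$ and let $C^{pwl}_J=\sum_{t=1}^T\sum_{j=1}^J M c_j\hat p^{dis}_{t,j}$ be the resulting aging cost. Benchmark. Let $s_0,s_1,\dots$ be the first point, the local extrema and the last point of the relative profile $e_0/E,\dots,e_T/E$. Rainflow counting inspects four consecutive points $s_0,s_1,s_2,s_3$, starting at the beginning of the profile: if $|s_1-s_2|\le|s_0-s_1|$ and $|s_1-s_2|\le|s_2-s_3|$, then a full cycle of depth $|s_1-s_2|$ is recorded, $s_1,s_2$ are removed, and the inspection goes on with $s_0,s_3,s_4,s_5$; otherwise it moves one point forward. This is repeated until no further full cycle is found in the remaining profile. Each decreasing step between adjacent points of the remaining profile is a discharge half cycle, whose depth is the size of the step. Let $\delta_1,\dots,\delta_m$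 be the depths of the full cycles and $\delta^{dis}_1,\dots,\delta^{dis}_n$ those of the discharge half cycles, and let $C^{ben}=R\sum_{i=1}^m\Phi(\delta_i)+R\sum_{i=1}^n\Phi(\delta^{dis}_i)$. Then $\lim_{J\to\infty}C^{pwl}_J=C^{ben}$. -/

import Mathlib

/-- The physical parameters of a battery: duration `M` of a dispatch interval, charge and discharge
power ratings `D` and `G`, charge and discharge efficiencies `ηch` and `ηdis`, energy capacity
`Erate`. -/
structure Battery where
  M : ℝ
  D : ℝ
  G : ℝ
  ηch : ℝ
  ηdis : ℝ
  Erate : ℝ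
  M_pos : 0 < M
  ηch_pos : 0 < ηch
  ηdis_pos : 0 < ηdis
  Erate_pos : 0 < Erate

namespace Battery

/-- Energy stored after `t` intervals, starting from `e₀`. Interval number `t` (counted from `0`)
leads from time `t` to time `t + 1`; `d t` and `g t` are the charge and discharge powers in it. -/
noncomputable def energy (B : Battery) (e₀ : ℝ) (d g : ℕ → ℝ) : ℕ → ℝ
  | 0 => e₀
  | t + 1 => energy B e₀ d g t + B.M * (d t * B.ηch - g t / B.ηdis)

/-- `(d, g)` is a feasible dispatch over `T` intervals from the initial energy `e₀`: powers are
nonnegative and within the ratings, the mode `v t` (`0` charging, `1` discharging) excludes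
simultaneous charge and discharge, and the stored energy stays between `0` and the capacity. -/
structure Feasible (B : Battery) (T : ℕ) (e₀ : ℝ) (d g : ℕ → ℝ) : Prop where
  mode : ∃ v : ℕ → ℝ, ∀ t < T, (v t = 0 ∨ v t = 1) ∧
    (0 ≤ d t ∧ d t ≤ B.D * (1 - v t)) ∧ (0 ≤ g t ∧ g t ≤ B.G * v t)
  energy_mem : ∀ t ≤ T, 0 ≤ B.energy e₀ d g t ∧ B.energy e₀ d g t ≤ B.Erate

end Battery

/-! ### The piecewise linear segment model

Segments are indexed by `j = 0, …, J - 1`; segment `j` is the depth range `[j / J, (j + 1) / J]`,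
so that smaller indices are shallower. -/

/-- Greedy allocation of an amount `a` to segments `0, 1, 2, …` with limits `u 0, u 1, u 2, …`:
each segment takes the minimum of what the shallower ones left over and of its own limit. -/
noncomputable def greedyAlloc (a : ℝ) (u : ℕ → ℝ) (j : ℕ) : ℝ :=
  min (a - ∑ i : Fin j, greedyAlloc a u i.1) (u j)
termination_by j
decreasing_by exact i.2

/-- Initial energy of segment `j` when every segment has capacity `ebar`. -/
noncomputable def initialSegmentEnergy (ebar e₀ : ℝ) (j : ℕ) : ℝ :=
  min ebar (max 0 (e₀ - ∑ i : Fin j, initialSegmentEnergy ebar e₀ i.1))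
termination_by j
decreasing_by exact i.2

namespace Battery

/-- Energy capacity of each of the `J` segments. -/
noncomputable def segmentCapacity (B : Battery) (J : ℕ) : ℝ := B.Erate / J

/-- Charge power of the segments in one interval of charge power `a`, if the segments hold the
energies `e` at the beginning of the interval. -/
noncomputable def chargePower (B : Battery) (J : ℕ) (a : ℝ) (e : ℕ → ℝ) : ℕ → ℝ :=
  greedyAlloc a fun j => (B.segmentCapacity J - e j) / (B.ηch * B.M)

/-- Discharge power of the segments in one interval of discharge power `a`, if the segments hold
the energies `e` at the beginning of the interval. -/
noncomputable def dischargePower (B : Battery) (a : ℝ) (e : ℕ → ℝ) : ℕ → ℝ :=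
  greedyAlloc a fun j => B.ηdis * e j / B.M

/-- Energy of segment `j` after `t` intervals in the greedy model with `J` segments. -/
noncomputable def segmentEnergy (B : Battery) (J : ℕ) (e₀ : ℝ) (d g : ℕ → ℝ) : ℕ → ℕ → ℝ
  | 0 => initialSegmentEnergy (B.segmentCapacity J) e₀
  | t + 1 => fun j =>
      let e := segmentEnergy B J e₀ d g t
      e j + B.M * (B.chargePower J (d t) e j * B.ηch - B.dischargePower (g t) e j / B.ηdis)

/-- Marginal aging cost of segment `j`, for the stress function `Φ` and replacement cost `R`. -/
noncomputable def marginalCost (B : Battery) (R : ℝ) (Φ : ℝ → ℝ) (J j : ℕ) : ℝ :=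
  R / (B.ηdis * B.Erate) * J * (Φ ((j + 1 : ℝ) / J) - Φ ((j : ℝ) / J))

/-- Aging cost of a dispatch over `T` intervals in the greedy model with `J` segments. -/
noncomputable def pwlCost (B : Battery) (R : ℝ) (Φ : ℝ → ℝ) (J T : ℕ) (e₀ : ℝ) (d g : ℕ → ℝ) : ℝ :=
  ∑ t ∈ Finset.range T, ∑ j ∈ Finset.range J,
    B.M * B.marginalCost R Φ J j * B.dischargePower (g t) (B.segmentEnergy J e₀ d g t) j

end Battery

/-! ### Rainflow counting -/

/-- The first point, the local extrema (points where the direction changes, a plateau counting as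
one point), and the last point of a finite profile. -/
noncomputable def turningPoints : List ℝ → List ℝ
  | a :: b :: c :: l =>
      if (a ≤ b ∧ b ≤ c) ∨ (c ≤ b ∧ b ≤ a) then turningPoints (a :: c :: l)
      else a :: turningPoints (b :: c :: l)
  | l => l
termination_by l => l.length

/-- One pass of the identification of full cycles through a profile: four consecutive points are
inspected; if the middle range is at most each of the two outer ones, it is a full cycle and the two
middle points are removed; otherwise the inspection moves one point forward. The result
consists of the depths of the full cycles found and of the remaining profile. -/
noncomputable def rainflowPass : List ℝ → List ℝ × List ℝ
  | s₀ :: s₁ :: s₂ :: s₃ :: l =>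
      if |s₁ - s₂| ≤ |s₀ - s₁| ∧ |s₁ - s₂| ≤ |s₂ - s₃| then
        (|s₁ - s₂| :: (rainflowPass (s₀ :: s₃ :: l)).1, (rainflowPass (s₀ :: s₃ :: l)).2)
      else
        ((rainflowPass (s₁ :: s₂ :: s₃ :: l)).1, s₀ :: (rainflowPass (s₁ :: s₂ :: s₃ :: l)).2)
  | l => ([], l)
termination_by l => l.length

theorem rainflowPass_length (l : List ℝ) :
    (rainflowPass l).2.length + 2 * (rainflowPass l).1.length = l.length := by
  induction l using rainflowPass.induct with
  | case1 s₀ s₁ s₂ s₃ l h ih =>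
    rw [rainflowPass, if_pos h]
    simp only [List.length_cons] at ih ⊢
    omega
  | case2 s₀ s₁ s₂ s₃ l h ih =>
    rw [rainflowPass, if_neg h]
    simp only [List.length_cons] at ih ⊢
    omega
  | case3 l h =>
    rw [rainflowPass]
    · simp
    · exact h

/-- Rainflow counting: passes are repeated until one finds no full cycle. The result consists of
the depths of all full cycles found and of the residue. -/
noncomputable def rainflow (l : List ℝ) : List ℝ × List ℝ :=
  if (rainflowPass l).1.length = 0 then ([], l)
  else ((rainflowPass l).1 ++ (rainflow (rainflowPass l).2).1, (rainflow (rainflowPass l).2).2)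
termination_by l.length
decreasing_by
  all_goals
    have := rainflowPass_length l
    omega

/-- Depths of the discharge half cycles, i.e. of the decreasing steps between adjacent points of a
residue. -/
noncomputable def dischargeHalfCycles : List ℝ → List ℝ
  | a :: b :: l =>
      if b < a then (a - b) :: dischargeHalfCycles (b :: l) else dischargeHalfCycles (b :: l)
  | _ => []

namespace Battery

/-- Relative state-of-charge profile at the times `0, …, T`. -/
noncomputable def socProfile (B : Battery) (T : ℕ) (e₀ : ℝ) (d g : ℕ → ℝ) : List ℝ :=
  (List.range (T + 1)).map fun t => B.energy e₀ d g t / B.Erate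

/-- Benchmark aging cost: every full cycle and every discharge half cycle identified by rainflow
counting costs `R * Φ depth`. -/
noncomputable def benchmarkCost (B : Battery) (R : ℝ) (Φ : ℝ → ℝ) (T : ℕ) (e₀ : ℝ)
    (d g : ℕ → ℝ) : ℝ :=
  let r := rainflow (turningPoints (B.socProfile T e₀ d g))
  R * (r.1.map Φ).sum + R * ((dischargeHalfCycles r.2).map Φ).sum

end Battery

/-! ### Stores of bounded capacity -/

/-! Look at the `n` shallowest of `J` segments together. Greedy allocation makes their total content
behave like one store of relative capacity `x = n / J`: it starts at `min s₀ x` and follows the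
increments of the state of charge, clipped to `[0, x]` (`segmentStep_sum`). The core is that the
total outflow of this store is the sum of `min δ x` over the depths `δ` of all full cycles and
discharge half cycles (`storeOutflow_eq_rainflow`). Intermediate points of monotone runs do not
matter; a full cycle can be cut out at the price of `min δ x`, whatever the content
(`storeOutflow_removeCycle`); and in the residue, whose ranges first grow and then shrink, each fall
of size `δ` draws exactly `min δ x` (`storeOutflow_of_cycleFree`).

Subtracting the identities for `n = j` and `n = j + 1` isolates segment `j`. Weighting by marginal
costs then gives, for each `J` and without error, the benchmark cost with `Φ` replaced by
`gridInterpolation Φ J` (`Feasible.pwlCost_eq`). The limit only concerns the pointwise convergence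
of these interpolants on `[0, 1]` (`tendsto_gridInterpolation`). -/

/-- The content of a store of capacity `x` that holds `w` after the increment `u` is offered to it;
what does not fit is lost. -/
noncomputable def storeStep (x w u : ℝ) : ℝ := max 0 (min x (w + u))

/-- Total outflow from a store of capacity `x` with initial content `w` that is driven by the
increments of a profile. -/
noncomputable def storeOutflow (x : ℝ) : ℝ → List ℝ → ℝ
  | w, a :: b :: l =>
      max 0 (w - storeStep x w (b - a)) + storeOutflow x (storeStep x w (b - a)) (b :: l)
  | _, _ => 0

theorem storeStep_nonneg (x w u : ℝ) : 0 ≤ storeStep x w u := le_max_left _ _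

theorem storeStep_le {x : ℝ} (hx : 0 ≤ x) (w u : ℝ) : storeStep x w u ≤ x :=
  max_le hx (min_le_left _ _)

theorem storeStep_of_nonneg {x w u : ℝ} (hw : 0 ≤ w) (hx : 0 ≤ x) (hu : 0 ≤ u) :
    storeStep x w u = min x (w + u) :=
  max_eq_right (le_min hx (add_nonneg hw hu))

theorem storeStep_of_nonpos {x w u : ℝ} (hwx : w ≤ x) (hu : u ≤ 0) :
    storeStep x w u = max 0 (w + u) := by
  rw [storeStep, min_eq_right (by linarith)]

theorem le_storeStep {x w u : ℝ} (hw : 0 ≤ w) (hwx : w ≤ x) (hu : 0 ≤ u) :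
    w ≤ storeStep x w u := by
  rw [storeStep_of_nonneg hw (hw.trans hwx) hu]
  exact le_min hwx (by linarith)

theorem storeStep_le_self {x w u : ℝ} (hw : 0 ≤ w) (hwx : w ≤ x) (hu : u ≤ 0) :
    storeStep x w u ≤ w := by
  rw [storeStep_of_nonpos hwx hu]
  exact max_le hw (by linarith)

theorem storeStep_div {E : ℝ} (hE : 0 < E) (x w u : ℝ) :
    storeStep x w u / E = storeStep (x / E) (w / E) (u / E) := by
  rw [storeStep, storeStep, ← add_div, min_div_div_right hE.le, ← max_div_div_right hE.le, zero_div]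

theorem storeOutflow_cons_of_le {x w a b : ℝ} (hw : 0 ≤ w) (hwx : w ≤ x) (hab : a ≤ b)
    (l : List ℝ) :
    storeOutflow x w (a :: b :: l) = storeOutflow x (min x (w + (b - a))) (b :: l) := by
  have h := le_storeStep hw hwx (sub_nonneg.2 hab)
  rw [storeOutflow, max_eq_left (by linarith), zero_add,
    storeStep_of_nonneg hw (hw.trans hwx) (sub_nonneg.2 hab)]

theorem storeOutflow_cons_of_ge {x w a b : ℝ} (hw : 0 ≤ w) (hwx : w ≤ x) (hab : b ≤ a)
    (l : List ℝ) :
    storeOutflow x w (a :: b :: l) =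
      w - max 0 (w + (b - a)) + storeOutflow x (max 0 (w + (b - a))) (b :: l) := by
  have h := storeStep_le_self hw hwx (sub_nonpos.2 hab)
  rw [storeOutflow, max_eq_right (by linarith), storeStep_of_nonpos hwx (sub_nonpos.2 hab)]

/-- An intermediate point of a monotone stretch does not influence the outflow. -/
theorem storeOutflow_of_between {x w a b c : ℝ} (hw : 0 ≤ w) (hwx : w ≤ x)
    (h : (a ≤ b ∧ b ≤ c) ∨ (c ≤ b ∧ b ≤ a)) (l : List ℝ) :
    storeOutflow x w (a :: b :: c :: l) = storeOutflow x w (a :: c :: l) := by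
  have hx := hw.trans hwx
  rcases h with ⟨hab, hbc⟩ | ⟨hcb, hba⟩
  · rw [storeOutflow_cons_of_le hw hwx hab, storeOutflow_cons_of_le hw hwx (hab.trans hbc),
      storeOutflow_cons_of_le (le_min hx (by linarith)) (min_le_left _ _) hbc]
    congr 1
    grind
  · have h : max 0 (max 0 (w + (b - a)) + (c - b)) = max 0 (w + (c - a)) := by grind
    rw [storeOutflow_cons_of_ge hw hwx hba, storeOutflow_cons_of_ge hw hwx (hcb.trans hba),
      storeOutflow_cons_of_ge (le_max_left _ _) (max_le hx (by linarith)) hcb, h]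
    ring

/-- Removing a full cycle from a rising or falling stretch reduces the outflow by the minimum of
its depth and the capacity. -/
theorem storeOutflow_removeCycle {x w a b c d : ℝ} (hw : 0 ≤ w) (hwx : w ≤ x)
    (h : (a ≤ c ∧ c ≤ b ∧ b ≤ d) ∨ (d ≤ b ∧ b ≤ c ∧ c ≤ a)) (l : List ℝ) :
    storeOutflow x w (a :: b :: c :: d :: l) =
      min |b - c| x + storeOutflow x w (a :: d :: l) := by
  have hx := hw.trans hwx
  rcases h with ⟨h1, h2, h3⟩ | ⟨h1, h2, h3⟩
  -- Rise, dip, rise. The first rise is at least `b - c`, so the store can yield `min (b - c) x` in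
  -- the dip; the last rise is at least as large and erases the trace of the dip.
  · have hb : 0 ≤ min x (w + (b - a)) := le_min hx (by linarith)
    rw [abs_of_nonneg (by linarith), storeOutflow_cons_of_le hw hwx (by linarith),
      storeOutflow_cons_of_ge hb (min_le_left _ _) h2,
      storeOutflow_cons_of_le (le_max_left _ _)
        (max_le hx (by linarith [min_le_left x (w + (b - a))])) (by linarith),
      storeOutflow_cons_of_le hw hwx (by linarith)]
    congr 1
    · grind
    · congr 1
      grind
  -- Fall, refill, fall. The first fall leaves room for `min (c - b) x`; this amount is taken in by
  -- the refill and flows out again in the last fall.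
  · have hb : max 0 (w + (b - a)) ≤ x := max_le hx (by linarith)
    have hc : 0 ≤ min x (max 0 (w + (b - a)) + (c - b)) :=
      le_min hx (by linarith [le_max_left 0 (w + (b - a))])
    have hcd : max 0 (min x (max 0 (w + (b - a)) + (c - b)) + (d - c)) = max 0 (w + (d - a)) := by
      grind
    have hbc : min x (max 0 (w + (b - a)) + (c - b)) - max 0 (w + (b - a)) = min (c - b) x := by
      grind
    rw [abs_of_nonpos (by linarith), storeOutflow_cons_of_ge hw hwx (by linarith),
      storeOutflow_cons_of_le (le_max_left _ _) hb h2,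
      storeOutflow_cons_of_ge hc (min_le_left _ _) (by linarith),
      storeOutflow_cons_of_ge hw hwx (by linarith), hcd, neg_sub, ← hbc]
    ring

/-- The head of a profile can be stripped if the remaining profiles are equivalent for every
content. -/
theorem storeOutflow_cons_congr {x c : ℝ} (hx : 0 ≤ x) {a b : ℝ} {l l' : List ℝ}
    (h : ∀ w, 0 ≤ w → w ≤ x → storeOutflow x w (b :: l) = c + storeOutflow x w (b :: l')) (w : ℝ) :
    storeOutflow x w (a :: b :: l) = c + storeOutflow x w (a :: b :: l') := by
  rw [storeOutflow, storeOutflow, h _ (storeStep_nonneg _ _ _) (storeStep_le hx _ _)]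
  ring

theorem storeOutflow_map_range {x : ℝ} (T : ℕ) (f W : ℕ → ℝ)
    (h : ∀ t < T, W (t + 1) = storeStep x (W t) (f (t + 1) - f t)) :
    storeOutflow x (W 0) ((List.range (T + 1)).map f) =
      ∑ t ∈ Finset.range T, max 0 (W t - W (t + 1)) := by
  induction T generalizing f W with
  | zero => simp [storeOutflow]
  | succ T ih =>
    have h0 := h 0 (Nat.succ_pos T)
    have := ih (fun t => f (t + 1)) (fun t => W (t + 1)) fun t ht => h (t + 1) (by omega)
    rw [List.range_succ_eq_map, List.map_cons, List.map_map] at this ⊢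
    rw [Finset.sum_range_succ', ← this, List.range_succ_eq_map]
    simp only [List.map_cons, List.map_map, storeOutflow]
    rw [add_comm, h0]
    rfl

/-! ### Zigzag profiles -/

/-- Consecutive steps of the profile are nonzero and have opposite directions. -/
def Zigzag : List ℝ → Prop
  | a :: b :: c :: l => ((a < b ∧ c < b) ∨ (b < a ∧ b < c)) ∧ Zigzag (b :: c :: l)
  | _ => True

theorem Zigzag.tail {a : ℝ} {l : List ℝ} (h : Zigzag (a :: l)) : Zigzag l := by
  match l, h with
  | [], _ => trivial
  | [_], _ => trivial
  | _ :: _ :: _, h => exact h.2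

/-- The first point of a zigzag profile may be moved as long as it stays on the same side of the
second one. -/
theorem Zigzag.replaceHead {a a' b : ℝ} {l : List ℝ} (h : Zigzag (a :: b :: l))
    (h1 : a < b → a' < b)
    (h2 : b < a → b < a') : Zigzag (a' :: b :: l) := by
  match l, h with
  | [], _ => trivial
  | _ :: _, h =>
    refine ⟨?_, h.2⟩
    rcases h.1 with h | h
    · exact .inl ⟨h1 h.1, h.2⟩
    · exact .inr ⟨h2 h.1, h.2⟩

/-- The second point can only move further along the initial direction. This keeps the zigzag
property when a point is put in front, and exposes the two leading points that
`storeOutflow_cons_congr` needs. -/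
theorem turningPoints_cons_cons (a b : ℝ) (l : List ℝ) :
    ∃ c l', turningPoints (a :: b :: l) = a :: c :: l' ∧ (a < b → b ≤ c) ∧ (b < a → c ≤ b) := by
  induction l generalizing a b with
  | nil => exact ⟨b, [], by simp [turningPoints], fun _ => le_rfl, fun _ => le_rfl⟩
  | cons c l ih =>
    rw [turningPoints]
    split_ifs with h
    · obtain ⟨e, l', he, h1, h2⟩ := ih a c
      exact ⟨e, l', he, by grind, by grind⟩
    · obtain ⟨e, l', he, -, -⟩ := ih b c
      exact ⟨b, e :: l', by rw [he], fun _ => le_rfl, fun _ => le_rfl⟩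

theorem zigzag_turningPoints (l : List ℝ) : Zigzag (turningPoints l) := by
  induction l using turningPoints.induct with
  | case1 a b c l h ih => rwa [turningPoints, if_pos h]
  | case2 a b c l h ih =>
    rw [turningPoints, if_neg h]
    obtain ⟨e, l', he, h1, h2⟩ := turningPoints_cons_cons b c l
    rw [he] at ih ⊢
    exact ⟨by grind, ih⟩
  | case3 l h =>
    match l, h with
    | [], _ => simp [turningPoints, Zigzag]
    | [_], _ => simp [turningPoints, Zigzag]
    | [_, _], _ => simp [turningPoints, Zigzag]
    | a :: b :: c :: l, h => exact absurd rfl (h a b c l)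

theorem turningPoints_subset (l : List ℝ) : turningPoints l ⊆ l := by
  induction l using turningPoints.induct with
  | case1 a b c l h ih =>
    rw [turningPoints, if_pos h]
    exact List.Subset.trans ih (by grind)
  | case2 a b c l h ih =>
    rw [turningPoints, if_neg h]
    exact List.cons_subset_cons _ ih
  | case3 l h => rw [turningPoints]; exacts [List.Subset.refl l, h]

theorem turningPoints_head? (l : List ℝ) : (turningPoints l).head? = l.head? := by
  induction l using turningPoints.induct with
  | case1 a b c l h ih => rw [turningPoints, if_pos h, ih]; rfl
  | case2 a b c l h ih => rw [turningPoints, if_neg h]; rfl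
  | case3 l h => rw [turningPoints]; exact h

theorem storeOutflow_turningPoints {x : ℝ} (l : List ℝ) (w : ℝ) (hw : 0 ≤ w) (hwx : w ≤ x) :
    storeOutflow x w (turningPoints l) = storeOutflow x w l := by
  induction l using turningPoints.induct generalizing w with
  | case1 a b c l h ih =>
    rw [turningPoints, if_pos h, ih w hw hwx, storeOutflow_of_between hw hwx h]
  | case2 a b c l h ih =>
    rw [turningPoints, if_neg h]
    obtain ⟨e, l', he, -, -⟩ := turningPoints_cons_cons b c l
    rw [he] at ih ⊢
    simpa using storeOutflow_cons_congr (c := 0) (hw.trans hwx) (a := a)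
      (fun w h1 h2 => by rw [ih w h1 h2, zero_add]) w
  | case3 l h => rw [turningPoints]; exact h

/-! ### Rainflow counting and the outflow of stores -/

theorem rainflowPass_snd_subset (l : List ℝ) : (rainflowPass l).2 ⊆ l := by
  induction l using rainflowPass.induct with
  | case1 a b c d l h ih =>
    rw [rainflowPass, if_pos h]
    exact List.Subset.trans ih (by grind)
  | case2 a b c d l h ih =>
    rw [rainflowPass, if_neg h]
    exact List.cons_subset_cons _ ih
  | case3 l h => rw [rainflowPass]; exacts [List.Subset.refl l, h]

/-- The initial content `min a x` is tied to the first point `a`, which therefore must survive every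
pass. -/
theorem rainflowPass_head? (l : List ℝ) : (rainflowPass l).2.head? = l.head? := by
  induction l using rainflowPass.induct with
  | case1 a b c d l h ih => rw [rainflowPass, if_pos h, ih]; rfl
  | case2 a b c d l h ih => rw [rainflowPass, if_neg h]; rfl
  | case3 l h => rw [rainflowPass]; exact h

/-- In a zigzag profile the middle range of a full cycle lies inside the two outer ones. -/
theorem Zigzag.nested {a b c d : ℝ} {l : List ℝ} (hz : Zigzag (a :: b :: c :: d :: l))
    (h : |b - c| ≤ |a - b| ∧ |b - c| ≤ |c - d|) :
    (a ≤ c ∧ c ≤ b ∧ b ≤ d) ∨ (d ≤ b ∧ b ≤ c ∧ c ≤ a) := by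
  obtain ⟨h1, h2, -⟩ := hz
  grind

/-- Seen from `d`, the point `a` is at least as far away as `c` and on the same side, so it can
replace `c` as the head. -/
theorem Zigzag.removeCycle {a b c d : ℝ} {l : List ℝ} (hz : Zigzag (a :: b :: c :: d :: l))
    (h : |b - c| ≤ |a - b| ∧ |b - c| ≤ |c - d|) : Zigzag (a :: d :: l) := by
  have hn := hz.nested h
  have hz' := hz.tail.tail
  obtain ⟨h1, h2, -⟩ := hz
  exact hz'.replaceHead (by grind) (by grind)

theorem rainflowPass_cons_cons {a b : ℝ} {l : List ℝ} (hz : Zigzag (a :: b :: l)) :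
    ∃ c l', (rainflowPass (a :: b :: l)).2 = a :: c :: l' ∧
      (a < b → a < c) ∧ (b < a → c < a) := by
  induction hn : l.length using Nat.strong_induction_on generalizing a b l with
  | _ n ih =>
    match l, hz, hn with
    | [], _, _ => exact ⟨b, [], by simp [rainflowPass], id, id⟩
    | [c], _, _ => exact ⟨b, [c], by simp [rainflowPass], id, id⟩
    | c :: d :: l, hz, hn =>
      rw [rainflowPass]
      split_ifs with h
      · obtain ⟨e, l', he, h1, h2⟩ := ih l.length (by simp at hn; omega) (hz.removeCycle h) rfl
        have hn := hz.nested h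
        exact ⟨e, l', he, by grind, by grind⟩
      · obtain ⟨e, l', he, -, -⟩ := ih (d :: l).length (by simp at hn ⊢; omega) hz.tail rfl
        exact ⟨b, e :: l', by rw [he], id, id⟩

theorem Zigzag.rainflowPass {l : List ℝ} (hz : Zigzag l) : Zigzag (rainflowPass l).2 := by
  induction l using rainflowPass.induct with
  | case1 a b c d l h ih =>
    rw [_root_.rainflowPass, if_pos h]
    exact ih (hz.removeCycle h)
  | case2 a b c d l h ih =>
    rw [_root_.rainflowPass, if_neg h]
    have := ih hz.tail
    obtain ⟨e, l', he, h1, h2⟩ := rainflowPass_cons_cons hz.tail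
    rw [he] at this ⊢
    have hb := hz.1
    exact ⟨by grind, this⟩
  | case3 l h => rw [_root_.rainflowPass]; exacts [hz, h]

/-- Validity for every content `w` is what carries the induction past a skipped point, which changes
the content. -/
theorem storeOutflow_rainflowPass {x : ℝ} {l : List ℝ} (hz : Zigzag l) (w : ℝ) (hw : 0 ≤ w)
    (hwx : w ≤ x) :
    storeOutflow x w l =
      ((rainflowPass l).1.map fun δ => min δ x).sum + storeOutflow x w (rainflowPass l).2 := by
  induction l using rainflowPass.induct generalizing w with
  | case1 a b c d l h ih =>
    rw [rainflowPass, if_pos h, storeOutflow_removeCycle hw hwx (hz.nested h),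
      ih (hz.removeCycle h) w hw hwx, List.map_cons, List.sum_cons, add_assoc]
  | case2 a b c d l h ih =>
    rw [rainflowPass, if_neg h]
    have ih := ih hz.tail
    obtain ⟨e, l', he, -, -⟩ := rainflowPass_cons_cons hz.tail
    rw [he] at ih ⊢
    exact storeOutflow_cons_congr (hw.trans hwx) ih w
  | case3 l h => rw [rainflowPass]; exacts [by simp, h]

theorem rainflowPass_fst_mem_Icc {l : List ℝ} (hl : ∀ s ∈ l, s ∈ Set.Icc (0 : ℝ) 1) :
    ∀ δ ∈ (rainflowPass l).1, δ ∈ Set.Icc (0 : ℝ) 1 := by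
  induction l using rainflowPass.induct with
  | case1 a b c d l h ih =>
    rw [rainflowPass, if_pos h]
    intro δ hδ
    rcases List.mem_cons.1 hδ with rfl | hδ
    · have hb := hl b (by simp)
      have hc := hl c (by simp)
      exact ⟨abs_nonneg _, abs_le.2 ⟨by linarith [hb.1, hc.2], by linarith [hb.2, hc.1]⟩⟩
    · exact ih (fun s hs => hl s (by grind)) δ hδ
  | case2 a b c d l h ih =>
    rw [rainflowPass, if_neg h]
    exact ih fun s hs => hl s (List.mem_cons_of_mem _ hs)
  | case3 l h => rw [rainflowPass]; exacts [by simp, h]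

/-! ### Residues of rainflow counting -/

/-- No four consecutive points of the profile form a full cycle. -/
def CycleFree : List ℝ → Prop
  | a :: b :: c :: d :: l =>
      ¬(|b - c| ≤ |a - b| ∧ |b - c| ≤ |c - d|) ∧ CycleFree (b :: c :: d :: l)
  | _ => True

theorem CycleFree.tail {a : ℝ} {l : List ℝ} (h : CycleFree (a :: l)) : CycleFree l := by
  match l, h with
  | [], _ => trivial
  | [_], _ => trivial
  | [_, _], _ => trivial
  | _ :: _ :: _ :: _, h => exact h.2

theorem cycleFree_of_rainflowPass {l : List ℝ} (h : (rainflowPass l).1.length = 0) :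
    CycleFree l := by
  induction l using rainflowPass.induct with
  | case1 a b c d l hc ih =>
    rw [rainflowPass, if_pos hc] at h
    simp at h
  | case2 a b c d l hc ih =>
    rw [rainflowPass, if_neg hc] at h
    exact ⟨hc, ih h⟩
  | case3 l hc =>
    match l, hc with
    | [], _ => trivial
    | [_], _ => trivial
    | [_, _], _ => trivial
    | [_, _, _], _ => trivial
    | a :: b :: c :: d :: l, hc => exact absurd rfl (hc a b c d l)

theorem dischargeHalfCycles_mem_Icc {l : List ℝ} (hl : ∀ s ∈ l, s ∈ Set.Icc (0 : ℝ) 1) :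
    ∀ δ ∈ dischargeHalfCycles l, δ ∈ Set.Icc (0 : ℝ) 1 := by
  match l with
  | [] => simp [dischargeHalfCycles]
  | [_] => simp [dischargeHalfCycles]
  | a :: b :: l =>
    have ih := dischargeHalfCycles_mem_Icc (l := b :: l)
      fun s hs => hl s (List.mem_cons_of_mem _ hs)
    have ha := hl a (by simp)
    have hb := hl b (by simp)
    rw [dischargeHalfCycles]
    split_ifs with h
    · intro δ hδ
      rcases List.mem_cons.1 hδ with rfl | hδ
      · exact ⟨by linarith, by linarith [ha.2, hb.1]⟩
      · exact ih δ hδ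
    · exact ih

/-- The outflow along a profile with shrinking ranges, if the first step meets enough content or
enough room. -/
theorem storeOutflow_of_converging {x : ℝ} {l : List ℝ} {a b w : ℝ} (hw : 0 ≤ w) (hwx : w ≤ x)
    (hz : Zigzag (a :: b :: l)) (hc : CycleFree (a :: b :: l))
    (hl : ∀ c ∈ l.head?, |b - c| ≤ |a - b|)
    (hdown : b < a → min (a - b) x ≤ w) (hup : a < b → min (b - a) x ≤ x - w) :
    storeOutflow x w (a :: b :: l) =
      ((dischargeHalfCycles (a :: b :: l)).map fun δ => min δ x).sum := by
  have hx := hw.trans hwx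
  induction l generalizing a b w with
  | nil =>
    rw [dischargeHalfCycles]
    split_ifs with h
    · rw [storeOutflow_cons_of_ge hw hwx h.le]
      simp [storeOutflow, dischargeHalfCycles]
      grind
    · rw [storeOutflow_cons_of_le hw hwx (not_lt.1 h)]
      simp [storeOutflow, dischargeHalfCycles]
  | cons c l ih =>
    have hbc := hl c (by simp)
    -- Without a full cycle, a range that is at most its predecessor is followed by a smaller one:
    -- shrinking persists.
    have hl' : ∀ d ∈ l.head?, |c - d| ≤ |b - c| := by
      intro d hd
      match l, hd with
      | e :: l, hd =>
        obtain rfl : e = d := by simpa using hd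
        have := hc.1
        grind
    have hdir := hz.1
    rw [dischargeHalfCycles]
    split_ifs with h
    -- The fall draws exactly `min (a - b) x` and leaves at least that much room, enough for the
    -- smaller rise that follows; a rise likewise provides the content for the next fall.
    · rw [storeOutflow_cons_of_ge hw hwx h.le, List.map_cons, List.sum_cons,
        ih (le_max_left _ _) (max_le hx (by linarith)) hz.tail hc.tail hl' (by grind) (by grind)]
      grind
    · rw [storeOutflow_cons_of_le hw hwx (not_lt.1 h),
        ih (le_min hx (by linarith)) (min_le_left _ _) hz.tail hc.tail hl' (by grind) (by grind)]

/-- The outflow along a residue of rainflow counting, if the shallow part of the store is filled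
first. -/
theorem storeOutflow_of_cycleFree {x : ℝ} (hx : 0 ≤ x) {l : List ℝ} {a : ℝ}
    (hpos : ∀ s ∈ a :: l, 0 ≤ s) (hz : Zigzag (a :: l)) (hc : CycleFree (a :: l)) :
    storeOutflow x (min a x) (a :: l) =
      ((dischargeHalfCycles (a :: l)).map fun δ => min δ x).sum := by
  induction hn : l.length using Nat.strong_induction_on generalizing a l with
  | _ n ih =>
    have ha : 0 ≤ a := hpos a (by simp)
    have hw : 0 ≤ min a x := le_min ha hx
    match l, hpos, hz, hc, hn with
    | [], _, _, _, _ => simp [storeOutflow, dischargeHalfCycles]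
    | b :: l, hpos, hz, hc, hn =>
      have hb : 0 ≤ b := hpos b (by simp)
      by_cases hab : b < a
      · by_cases hconv : ∀ c ∈ l.head?, |b - c| ≤ |a - b|
        · exact storeOutflow_of_converging hw (min_le_right _ _) hz hc hconv (by grind) (by grind)
        · match l, hpos, hz, hc, hn, hconv with
          | [], _, _, _, _, hconv => simp at hconv
          | c :: l, hpos, hz, hc, hn, hconv =>
            have hconv : |a - b| < |b - c| := by simpa using hconv
            have hdir := hz.1
            have hac : a < c := by grind
            -- Since `0 ≤ b`, the fall `a - b` is at most `a`, so the content `min a x` suffices.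
            have h1 : min a x - max 0 (min a x + (b - a)) = min (a - b) x := by grind
            -- The content at `b` need not be `min b x`, but the larger rise to `c` restores the
            -- invariant. Hence two points are consumed at once.
            have h2 : min x (max 0 (min a x + (b - a)) + (c - b)) = min c x := by grind
            rw [storeOutflow_cons_of_ge hw (min_le_right _ _) hab.le,
              storeOutflow_cons_of_le (le_max_left _ _)
                (max_le hx (by linarith [min_le_right a x])) (by linarith), h1, h2,
              ih l.length (by simp at hn; omega) (fun s hs => hpos s (by grind)) hz.tail.tail
                hc.tail.tail rfl]
            simp [dischargeHalfCycles, hab, (hab.trans hac).not_gt]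
      · have h1 : min x (min a x + (b - a)) = min b x := by grind
        rw [storeOutflow_cons_of_le hw (min_le_right _ _) (not_lt.1 hab), h1,
          ih l.length (by simp at hn; omega) (fun s hs => hpos s (by grind)) hz.tail hc.tail rfl,
          dischargeHalfCycles, if_neg hab]

theorem rainflow_mem_Icc {l : List ℝ} (hl : ∀ s ∈ l, s ∈ Set.Icc (0 : ℝ) 1) :
    ∀ δ ∈ (rainflow l).1 ++ dischargeHalfCycles (rainflow l).2, δ ∈ Set.Icc (0 : ℝ) 1 := by
  induction l using rainflow.induct with
  | case1 l h =>
    rw [rainflow, if_pos h]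
    simpa using dischargeHalfCycles_mem_Icc hl
  | case2 l h ih =>
    rw [rainflow, if_neg h]
    have ih := ih fun s hs => hl s (rainflowPass_snd_subset l hs)
    have := rainflowPass_fst_mem_Icc hl
    grind

/-- Rainflow counting computes the outflow of the stores of all capacities. -/
theorem storeOutflow_eq_rainflow {x : ℝ} (hx : 0 ≤ x) {l : List ℝ} {a : ℝ} (ha : l.head? = some a)
    (hpos : ∀ s ∈ l, 0 ≤ s) (hz : Zigzag l) :
    storeOutflow x (min a x) l =
      (((rainflow l).1 ++ dischargeHalfCycles (rainflow l).2).map fun δ => min δ x).sum := by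
  induction l using rainflow.induct with
  | case1 l h =>
    rw [rainflow, if_pos h]
    obtain ⟨l, rfl⟩ : ∃ l', l = a :: l' := List.head?_eq_some_iff.1 ha
    exact storeOutflow_of_cycleFree hx hpos hz (cycleFree_of_rainflowPass h)
  | case2 l h ih =>
    have ha0 : 0 ≤ a := hpos a (List.mem_of_mem_head? (by simp [ha]))
    rw [rainflow, if_neg h, storeOutflow_rainflowPass hz _ (le_min ha0 hx) (min_le_right _ _),
      ih ((rainflowPass_head? l).trans ha) (fun s hs => hpos s (rainflowPass_snd_subset l hs))
        hz.rainflowPass]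
    simp

/-! ### Piecewise linear interpolation -/

/-- The piecewise linear interpolation of `Φ - Φ 0` on `[0, 1]` at the points `j / J`. -/
noncomputable def gridInterpolation (Φ : ℝ → ℝ) (J : ℕ) (δ : ℝ) : ℝ :=
  ∑ j ∈ Finset.range J, J * (Φ ((j + 1 : ℝ) / J) - Φ ((j : ℝ) / J)) *
    (min δ ((j + 1 : ℝ) / J) - min δ ((j : ℝ) / J))

/-- Cells below `δ` contribute the full increments of `Φ`, which telescope. -/
theorem sum_gridInterpolation_of_le {Φ : ℝ → ℝ} (hΦ0 : Φ 0 = 0) {J n : ℕ} (hJ : 0 < J) {δ : ℝ}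
    (hn : (n : ℝ) / J ≤ δ) :
    ∑ j ∈ Finset.range n, J * (Φ ((j + 1 : ℝ) / J) - Φ ((j : ℝ) / J)) *
      (min δ ((j + 1 : ℝ) / J) - min δ ((j : ℝ) / J)) = Φ ((n : ℝ) / J) := by
  have hJ' : (0 : ℝ) < J := Nat.cast_pos.2 hJ
  have hterm : ∀ j ∈ Finset.range n, J * (Φ ((j + 1 : ℝ) / J) - Φ ((j : ℝ) / J)) *
      (min δ ((j + 1 : ℝ) / J) - min δ ((j : ℝ) / J)) =
        Φ (((j + 1 : ℕ) : ℝ) / J) - Φ ((j : ℝ) / J) := by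
    intro j hj
    have hjn : (j + 1 : ℝ) ≤ n := by exact_mod_cast Finset.mem_range.1 hj
    have h1 : (j + 1 : ℝ) / J ≤ δ := (div_le_div_of_nonneg_right hjn hJ'.le).trans hn
    have h0 : (j : ℝ) / J ≤ δ :=
      (div_le_div_of_nonneg_right (by linarith) hJ'.le).trans h1
    rw [min_eq_right h1, min_eq_right h0]
    push_cast
    field_simp
    ring
  rw [Finset.sum_congr rfl hterm, Finset.sum_range_sub fun j : ℕ => Φ ((j : ℝ) / J)]
  simp [hΦ0]

theorem gridInterpolation_eq {Φ : ℝ → ℝ} (hΦ0 : Φ 0 = 0) {J k : ℕ} (hkJ : k < J) {δ : ℝ}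
    (h1 : (k : ℝ) / J ≤ δ) (h2 : δ ≤ (k + 1 : ℝ) / J) :
    gridInterpolation Φ J δ =
      Φ ((k : ℝ) / J) + (J * δ - k) * (Φ ((k + 1 : ℝ) / J) - Φ ((k : ℝ) / J)) := by
  have hJ : 0 < J := by omega
  have hJ' : (0 : ℝ) < J := Nat.cast_pos.2 hJ
  rw [gridInterpolation, ← Finset.sum_subset (Finset.range_mono (Nat.succ_le_of_lt hkJ)),
    Finset.sum_range_succ, sum_gridInterpolation_of_le hΦ0 hJ h1, min_eq_left h2,
    min_eq_right h1]
  · field_simp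
  · intro j _ hj
    have hjk : (k + 1 : ℝ) ≤ j := by
      have : k + 1 ≤ j := by simpa using hj
      exact_mod_cast this
    have h3 : δ ≤ (j : ℝ) / J := h2.trans (div_le_div_of_nonneg_right hjk hJ'.le)
    have h4 : δ ≤ (j + 1 : ℝ) / J :=
      h3.trans (div_le_div_of_nonneg_right (by linarith) hJ'.le)
    rw [min_eq_left h3, min_eq_left h4, sub_self, mul_zero]

theorem tendsto_gridInterpolation {Φ : ℝ → ℝ} (hΦ : ConvexOn ℝ (Set.Icc 0 1) Φ) (hΦ0 : Φ 0 = 0)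
    {δ : ℝ} (hδ : δ ∈ Set.Icc (0 : ℝ) 1) :
    Filter.Tendsto (fun J : ℕ => gridInterpolation Φ J δ) Filter.atTop (nhds (Φ δ)) := by
  -- A convex function may jump at the ends of `[0, 1]`, but there the interpolant is exact;
  -- continuity is needed only inside.
  rcases hδ.2.eq_or_lt with rfl | hδ1
  · refine tendsto_const_nhds.congr' ?_
    filter_upwards [Filter.eventually_gt_atTop 0] with J hJ
    have hJ' : (J : ℝ) ≠ 0 := by positivity
    have := sum_gridInterpolation_of_le hΦ0 hJ (n := J) (δ := 1) (by rw [div_self hJ'])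
    rw [div_self hJ'] at this
    exact this.symm
  rcases hδ.1.eq_or_lt with rfl | hδ0
  · have h : ∀ J : ℕ, gridInterpolation Φ J 0 = 0 := fun J =>
      Finset.sum_eq_zero fun j _ => by
        rw [min_eq_left (by positivity), min_eq_left (by positivity), sub_self, mul_zero]
    simp [h, hΦ0]
  have hcont : ContinuousAt Φ δ := by
    have := hΦ.continuousOn_interior
    rw [interior_Icc] at this
    exact this.continuousAt (Ioo_mem_nhds hδ0 hδ1)
  have hk : Filter.Tendsto (fun J : ℕ => (⌊δ * J⌋₊ : ℝ) / J) Filter.atTop (nhds δ) :=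
    (tendsto_nat_floor_mul_div_atTop hδ0.le).comp tendsto_natCast_atTop_atTop
  have hk1 : Filter.Tendsto (fun J : ℕ => (⌊δ * J⌋₊ + 1 : ℝ) / J) Filter.atTop (nhds δ) := by
    simpa [add_div] using hk.add (tendsto_const_div_atTop_nhds_zero_nat (1 : ℝ))
  have hdiff := (hcont.tendsto.comp hk1).sub (hcont.tendsto.comp hk)
  rw [sub_self] at hdiff
  have hbdd : ∀ J : ℕ, |(J : ℝ) * δ - ⌊δ * J⌋₊| ≤ 1 := fun J => by
    have h1 := Nat.floor_le (a := δ * J) (by positivity)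
    have h2 := Nat.lt_floor_add_one (δ * J)
    exact abs_le.2 ⟨by linarith, by linarith⟩
  -- The interpolation weight is bounded and the increment of `Φ` over the cell around `δ` vanishes.
  have hprod : Filter.Tendsto (fun J : ℕ => ((J : ℝ) * δ - ⌊δ * J⌋₊) *
      (Φ ((⌊δ * J⌋₊ + 1 : ℝ) / J) - Φ ((⌊δ * J⌋₊ : ℝ) / J))) Filter.atTop (nhds 0) := by
    refine squeeze_zero_norm (fun J => ?_) (tendsto_zero_iff_norm_tendsto_zero.1 hdiff)
    rw [norm_mul]
    exact mul_le_of_le_one_left (norm_nonneg _) (hbdd J)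
  have := (hcont.tendsto.comp hk).add hprod
  rw [add_zero] at this
  refine this.congr' ?_
  filter_upwards [Filter.eventually_gt_atTop 0] with J hJ
  have hJ' : (0 : ℝ) < J := Nat.cast_pos.2 hJ
  have hfl := Nat.floor_le (a := δ * J) (by positivity)
  refine (gridInterpolation_eq hΦ0 (k := ⌊δ * J⌋₊) ?_ ?_ ?_).symm
  · have : (⌊δ * J⌋₊ : ℝ) < J := hfl.trans_lt (by nlinarith)
    exact_mod_cast this
  · rwa [div_le_iff₀ hJ']
  · rw [le_div_iff₀ hJ']
    exact (Nat.lt_floor_add_one _).le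

/-! ### Greedy allocation -/

/-- If the first `n` segments leave anything over, each of them is at its limit. Thus a prefix acts
as a single segment. -/
theorem sum_greedyAlloc {a : ℝ} {u : ℕ → ℝ} (ha : 0 ≤ a) (hu : ∀ j, 0 ≤ u j) (n : ℕ) :
    ∑ j ∈ Finset.range n, greedyAlloc a u j = min a (∑ j ∈ Finset.range n, u j) := by
  induction n with
  | zero => simp [ha]
  | succ n ih =>
    rw [Finset.sum_range_succ, Finset.sum_range_succ, greedyAlloc,
      Fin.sum_univ_eq_sum_range (fun i => greedyAlloc a u i), ih]
    grind

theorem greedyAlloc_le (a : ℝ) (u : ℕ → ℝ) (j : ℕ) : greedyAlloc a u j ≤ u j := by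
  rw [greedyAlloc]
  exact min_le_right _ _

theorem greedyAlloc_nonneg {a : ℝ} {u : ℕ → ℝ} (ha : 0 ≤ a) (hu : ∀ j, 0 ≤ u j) (j : ℕ) :
    0 ≤ greedyAlloc a u j := by
  rw [greedyAlloc, Fin.sum_univ_eq_sum_range (fun i => greedyAlloc a u i), sum_greedyAlloc ha hu]
  exact le_min (sub_nonneg.2 (min_le_left _ _)) (hu j)

theorem greedyAlloc_zero {u : ℕ → ℝ} (hu : ∀ j, 0 ≤ u j) (j : ℕ) : greedyAlloc 0 u j = 0 := by
  refine le_antisymm ?_ (greedyAlloc_nonneg le_rfl hu j)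
  rw [greedyAlloc]
  exact (min_le_left _ _).trans
    (by simpa using Finset.sum_nonneg fun (i : Fin j) _ => greedyAlloc_nonneg le_rfl hu i.1)

theorem sum_initialSegmentEnergy {ebar e₀ : ℝ} (hebar : 0 ≤ ebar) (he₀ : 0 ≤ e₀) (n : ℕ) :
    ∑ j ∈ Finset.range n, initialSegmentEnergy ebar e₀ j = min e₀ (n * ebar) := by
  induction n with
  | zero => simp [he₀]
  | succ n ih =>
    rw [Finset.sum_range_succ, initialSegmentEnergy,
      Fin.sum_univ_eq_sum_range (fun i => initialSegmentEnergy ebar e₀ i), ih]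
    push_cast
    grind

theorem initialSegmentEnergy_mem {ebar : ℝ} (hebar : 0 ≤ ebar) (e₀ : ℝ) (j : ℕ) :
    initialSegmentEnergy ebar e₀ j ∈ Set.Icc 0 ebar := by
  rw [initialSegmentEnergy]
  exact ⟨le_min hebar (le_max_left _ _), min_le_left _ _⟩

/-! ### The segment model -/

namespace Battery

/-- Each interval moves energy one way only, so the outflow can be read off the change of content.
-/
theorem Feasible.charge_or_discharge {B : Battery} {T : ℕ} {e₀ : ℝ} {d g : ℕ → ℝ}
    (h : B.Feasible T e₀ d g) {t : ℕ} (ht : t < T) :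
    (0 ≤ d t ∧ g t = 0) ∨ (d t = 0 ∧ 0 ≤ g t) := by
  obtain ⟨v, hv⟩ := h.mode
  obtain ⟨h0 | h1, ⟨hd, hd'⟩, hg, hg'⟩ := hv t ht
  · rw [h0, mul_zero] at hg'
    exact .inl ⟨hd, le_antisymm hg' hg⟩
  · rw [h1, sub_self, mul_zero] at hd'
    exact .inr ⟨le_antisymm hd' hd, hg⟩

theorem segmentCapacity_nonneg (B : Battery) (J : ℕ) : 0 ≤ B.segmentCapacity J :=
  div_nonneg B.Erate_pos.le (Nat.cast_nonneg J)

section Step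

variable {B : Battery} {J : ℕ} {e : ℕ → ℝ}

theorem chargeLimit_nonneg (he : ∀ j, e j ∈ Set.Icc 0 (B.segmentCapacity J)) (j : ℕ) :
    0 ≤ (B.segmentCapacity J - e j) / (B.ηch * B.M) :=
  div_nonneg (sub_nonneg.2 (he j).2) (mul_pos B.ηch_pos B.M_pos).le

theorem dischargeLimit_nonneg (he : ∀ j, e j ∈ Set.Icc 0 (B.segmentCapacity J)) (j : ℕ) :
    0 ≤ B.ηdis * e j / B.M :=
  div_nonneg (mul_nonneg B.ηdis_pos.le (he j).1) B.M_pos.le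

theorem sum_chargePower (he : ∀ j, e j ∈ Set.Icc 0 (B.segmentCapacity J)) {a : ℝ} (ha : 0 ≤ a)
    (n : ℕ) :
    B.M * B.ηch * ∑ j ∈ Finset.range n, B.chargePower J a e j =
      min (B.M * B.ηch * a) (n * B.segmentCapacity J - ∑ j ∈ Finset.range n, e j) := by
  have hM := B.M_pos
  have hη := B.ηch_pos
  unfold chargePower
  rw [sum_greedyAlloc ha (chargeLimit_nonneg he), mul_min_of_nonneg _ _ (by positivity),
    ← Finset.sum_div, Finset.sum_sub_distrib, Finset.sum_const, Finset.card_range, nsmul_eq_mul]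
  congr 1
  field_simp

theorem sum_dischargePower (he : ∀ j, e j ∈ Set.Icc 0 (B.segmentCapacity J)) {a : ℝ} (ha : 0 ≤ a)
    (n : ℕ) :
    B.M / B.ηdis * ∑ j ∈ Finset.range n, B.dischargePower a e j =
      min (B.M / B.ηdis * a) (∑ j ∈ Finset.range n, e j) := by
  have hM := B.M_pos
  have hη := B.ηdis_pos
  unfold dischargePower
  rw [sum_greedyAlloc ha (dischargeLimit_nonneg he), mul_min_of_nonneg _ _ (by positivity),
    ← Finset.sum_div, ← Finset.mul_sum]
  congr 1
  field_simp

theorem segmentStep_mem (he : ∀ j, e j ∈ Set.Icc 0 (B.segmentCapacity J)) {a b : ℝ}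
    (hab : (0 ≤ a ∧ b = 0) ∨ (a = 0 ∧ 0 ≤ b)) (j : ℕ) :
    e j + B.M * (B.chargePower J a e j * B.ηch - B.dischargePower b e j / B.ηdis) ∈
      Set.Icc 0 (B.segmentCapacity J) := by
  have hM := B.M_pos
  have hη := B.ηch_pos
  have hη' := B.ηdis_pos
  obtain ⟨h0, h1⟩ := he j
  rcases hab with ⟨ha, rfl⟩ | ⟨rfl, hb⟩
  · have hz : B.dischargePower 0 e j = 0 := greedyAlloc_zero (dischargeLimit_nonneg he) j
    have hp : 0 ≤ B.chargePower J a e j := greedyAlloc_nonneg ha (chargeLimit_nonneg he) j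
    have hl : B.chargePower J a e j ≤ (B.segmentCapacity J - e j) / (B.ηch * B.M) :=
      greedyAlloc_le _ _ j
    rw [le_div_iff₀ (by positivity)] at hl
    rw [hz, zero_div, sub_zero]
    exact ⟨by positivity, by linarith⟩
  · have hz : B.chargePower J 0 e j = 0 := greedyAlloc_zero (chargeLimit_nonneg he) j
    have hp : 0 ≤ B.dischargePower b e j := greedyAlloc_nonneg hb (dischargeLimit_nonneg he) j
    have hl : B.dischargePower b e j ≤ B.ηdis * e j / B.M := greedyAlloc_le _ _ j
    have hl' : B.M * (B.dischargePower b e j / B.ηdis) ≤ e j := by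
      rw [le_div_iff₀ hM] at hl
      rw [← mul_div_assoc, div_le_iff₀ hη']
      linarith
    have hp' : 0 ≤ B.M * (B.dischargePower b e j / B.ηdis) := by positivity
    rw [hz, zero_mul]
    exact ⟨by linarith, by linarith⟩

/-- The `n` shallowest segments together act as a single store, and their discharge is its
outflow. -/
theorem segmentStep_sum (he : ∀ j, e j ∈ Set.Icc 0 (B.segmentCapacity J)) {a b : ℝ}
    (hab : (0 ≤ a ∧ b = 0) ∨ (a = 0 ∧ 0 ≤ b)) (n : ℕ) :
    ∑ j ∈ Finset.range n,
        (e j + B.M * (B.chargePower J a e j * B.ηch - B.dischargePower b e j / B.ηdis)) =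
      storeStep (n * B.segmentCapacity J) (∑ j ∈ Finset.range n, e j)
        (B.M * (a * B.ηch - b / B.ηdis)) ∧
    B.M / B.ηdis * ∑ j ∈ Finset.range n, B.dischargePower b e j =
      max 0 (∑ j ∈ Finset.range n, e j - storeStep (n * B.segmentCapacity J)
        (∑ j ∈ Finset.range n, e j) (B.M * (a * B.ηch - b / B.ηdis))) := by
  have hM := B.M_pos
  have hη := B.ηch_pos
  have hη' := B.ηdis_pos
  have hW : 0 ≤ ∑ j ∈ Finset.range n, e j := Finset.sum_nonneg fun j _ => (he j).1
  have hWx : ∑ j ∈ Finset.range n, e j ≤ n * B.segmentCapacity J := by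
    simpa using Finset.sum_le_card_nsmul (Finset.range n) e _ fun j _ => (he j).2
  have hsum : ∑ j ∈ Finset.range n,
      (e j + B.M * (B.chargePower J a e j * B.ηch - B.dischargePower b e j / B.ηdis)) =
      ∑ j ∈ Finset.range n, e j + B.M * B.ηch * ∑ j ∈ Finset.range n, B.chargePower J a e j -
        B.M / B.ηdis * ∑ j ∈ Finset.range n, B.dischargePower b e j := by
    rw [Finset.mul_sum, Finset.mul_sum, ← Finset.sum_add_distrib, ← Finset.sum_sub_distrib]
    exact Finset.sum_congr rfl fun j _ => by ring
  rw [hsum]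
  rcases hab with ⟨ha, rfl⟩ | ⟨rfl, hb⟩
  -- Charging: `W + min u (x - W) = min x (W + u)`, with no outflow.
  · have hu : 0 ≤ B.M * B.ηch * a := by positivity
    rw [sum_chargePower he ha, sum_dischargePower he le_rfl, zero_div, sub_zero,
      show B.M * (a * B.ηch) = B.M * B.ηch * a by ring, mul_zero, min_eq_left hW,
      storeStep_of_nonneg hW (hW.trans hWx) hu]
    clear hsum he
    generalize ∑ j ∈ Finset.range n, e j = W at hW hWx ⊢
    generalize B.M * B.ηch * a = u at hu ⊢
    generalize n * B.segmentCapacity J = x at hWx ⊢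
    grind
  -- Discharging: `W - min u W = max 0 (W - u)`.
  · have hu : 0 ≤ B.M / B.ηdis * b := by positivity
    rw [sum_chargePower he le_rfl, sum_dischargePower he hb, zero_mul, zero_sub,
      show B.M * (-(b / B.ηdis)) = -(B.M / B.ηdis * b) by ring, mul_zero,
      min_eq_left (sub_nonneg.2 hWx), storeStep_of_nonpos hWx (neg_nonpos.2 hu)]
    clear hsum he
    generalize ∑ j ∈ Finset.range n, e j = W at hW hWx ⊢
    generalize B.M / B.ηdis * b = u at hu ⊢
    generalize n * B.segmentCapacity J = x at hWx ⊢
    grind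

end Step

/-! ### The segment model over a whole dispatch -/

variable {B : Battery} {T : ℕ} {e₀ : ℝ} {d g : ℕ → ℝ}

theorem Feasible.segmentEnergy_mem (h : B.Feasible T e₀ d g) (J : ℕ) {t : ℕ} (ht : t ≤ T) (j : ℕ) :
    B.segmentEnergy J e₀ d g t j ∈ Set.Icc 0 (B.segmentCapacity J) := by
  induction t generalizing j with
  | zero => exact initialSegmentEnergy_mem (B.segmentCapacity_nonneg J) e₀ j
  | succ t ih =>
    exact segmentStep_mem (fun j => ih (by omega) j) (h.charge_or_discharge (by omega)) j

theorem Feasible.socProfile_mem (h : B.Feasible T e₀ d g) :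
    ∀ s ∈ B.socProfile T e₀ d g, s ∈ Set.Icc (0 : ℝ) 1 := by
  intro s hs
  obtain ⟨t, ht, rfl⟩ := List.mem_map.1 hs
  obtain ⟨h0, h1⟩ := h.energy_mem t (by simp at ht; omega)
  exact ⟨div_nonneg h0 B.Erate_pos.le, (div_le_one B.Erate_pos).2 h1⟩

/-- The depths of all full cycles and discharge half cycles of a dispatch. -/
noncomputable def cycleDepths (B : Battery) (T : ℕ) (e₀ : ℝ) (d g : ℕ → ℝ) : List ℝ :=
  let r := rainflow (turningPoints (B.socProfile T e₀ d g))
  r.1 ++ dischargeHalfCycles r.2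

theorem benchmarkCost_eq (B : Battery) (R : ℝ) (Φ : ℝ → ℝ) (T : ℕ) (e₀ : ℝ) (d g : ℕ → ℝ) :
    B.benchmarkCost R Φ T e₀ d g = R * ((B.cycleDepths T e₀ d g).map Φ).sum := by
  simp [benchmarkCost, cycleDepths, mul_add]

theorem Feasible.cycleDepths_mem (h : B.Feasible T e₀ d g) :
    ∀ δ ∈ B.cycleDepths T e₀ d g, δ ∈ Set.Icc (0 : ℝ) 1 :=
  rainflow_mem_Icc fun s hs => h.socProfile_mem s (turningPoints_subset _ hs)

/-- The relative energy discharged from the `n` shallowest segments counts every cycle up to the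
depth of these segments. -/
theorem Feasible.sum_dischargePower_eq (h : B.Feasible T e₀ d g) (J n : ℕ) :
    ∑ t ∈ Finset.range T, B.M / B.ηdis / B.Erate *
        ∑ j ∈ Finset.range n, B.dischargePower (g t) (B.segmentEnergy J e₀ d g t) j =
      ((B.cycleDepths T e₀ d g).map fun δ => min δ ((n : ℝ) / J)).sum := by
  have hE := B.Erate_pos
  have hx : (0 : ℝ) ≤ (n : ℝ) / J := by positivity
  have he₀ : 0 ≤ e₀ := (h.energy_mem 0 (Nat.zero_le T)).1
  -- For `J = 0` both sides are `0` by the convention for division.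
  have hcap : n * B.segmentCapacity J / B.Erate = (n : ℝ) / J := by
    rw [segmentCapacity]
    field_simp
  set W : ℕ → ℝ := fun t => (∑ j ∈ Finset.range n, B.segmentEnergy J e₀ d g t j) / B.Erate
    with hW
  have hstep : ∀ t < T, W (t + 1) = storeStep ((n : ℝ) / J) (W t)
      (B.energy e₀ d g (t + 1) / B.Erate - B.energy e₀ d g t / B.Erate) ∧
      B.M / B.ηdis / B.Erate *
        ∑ j ∈ Finset.range n, B.dischargePower (g t) (B.segmentEnergy J e₀ d g t) j =
      max 0 (W t - W (t + 1)) := by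
    intro t ht
    obtain ⟨h1, h2⟩ := segmentStep_sum (fun j => h.segmentEnergy_mem J ht.le j)
      (h.charge_or_discharge ht) n
    rw [← h1] at h2
    constructor
    · rw [← sub_div, energy, add_sub_cancel_left, ← hcap, ← storeStep_div hE, ← h1]
      rfl
    · rw [div_mul_eq_mul_div, h2, ← sub_div, ← zero_div B.Erate, max_div_div_right hE.le,
        zero_div]
      rfl
  -- Filling the shallow segments first gives exactly the initial content for which the residue is
  -- counted correctly.
  have hW0 : W 0 = min (e₀ / B.Erate) ((n : ℝ) / J) := by
    rw [← hcap, min_div_div_right hE.le,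
      ← sum_initialSegmentEnergy (B.segmentCapacity_nonneg J) he₀]
    rfl
  have hhead : (turningPoints (B.socProfile T e₀ d g)).head? = some (e₀ / B.Erate) := by
    rw [turningPoints_head?, socProfile, List.range_succ_eq_map]
    rfl
  have hpos : 0 ≤ e₀ / B.Erate := div_nonneg he₀ hE.le
  rw [Finset.sum_congr rfl fun t ht => (hstep t (Finset.mem_range.1 ht)).2,
    ← storeOutflow_map_range T (fun t => B.energy e₀ d g t / B.Erate) W fun t ht => (hstep t ht).1,
    hW0, cycleDepths, ← storeOutflow_eq_rainflow hx hhead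
      (fun s hs => (h.socProfile_mem s (turningPoints_subset _ hs)).1) (zigzag_turningPoints _),
    storeOutflow_turningPoints _ _ (le_min hpos hx) (min_le_right _ _)]
  rfl

/-- The segment model charges every cycle according to the interpolated stress function. -/
theorem Feasible.pwlCost_eq (h : B.Feasible T e₀ d g) (R : ℝ) (Φ : ℝ → ℝ) (J : ℕ) :
    B.pwlCost R Φ J T e₀ d g =
      R * ((B.cycleDepths T e₀ d g).map (gridInterpolation Φ J)).sum := by
  have hseg : ∀ j : ℕ, ∑ t ∈ Finset.range T, B.M / B.ηdis / B.Erate *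
      B.dischargePower (g t) (B.segmentEnergy J e₀ d g t) j =
      ((B.cycleDepths T e₀ d g).map fun δ =>
        min δ ((j + 1 : ℝ) / J) - min δ ((j : ℝ) / J)).sum := by
    intro j
    have h1 := h.sum_dischargePower_eq J (j + 1)
    simp only [Finset.sum_range_succ, mul_add, Finset.sum_add_distrib,
      h.sum_dischargePower_eq J j] at h1
    push_cast at h1
    rw [eq_sub_of_add_eq' h1]
    clear h1
    induction B.cycleDepths T e₀ d g with
    | nil => simp
    | cons δ l ih =>
      simp only [List.map_cons, List.sum_cons, ← ih]
      ring
  have hint : ((B.cycleDepths T e₀ d g).map (gridInterpolation Φ J)).sum =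
      ∑ j ∈ Finset.range J, J * (Φ ((j + 1 : ℝ) / J) - Φ ((j : ℝ) / J)) *
        ((B.cycleDepths T e₀ d g).map fun δ =>
          min δ ((j + 1 : ℝ) / J) - min δ ((j : ℝ) / J)).sum := by
    induction B.cycleDepths T e₀ d g with
    | nil => simp
    | cons δ l ih =>
      simp only [List.map_cons, List.sum_cons, mul_add, Finset.sum_add_distrib, ih]
      rfl
  rw [pwlCost, Finset.sum_comm, hint, Finset.mul_sum]
  refine Finset.sum_congr rfl fun j _ => ?_
  rw [← hseg, Finset.mul_sum, Finset.mul_sum]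
  refine Finset.sum_congr rfl fun t _ => ?_
  rw [marginalCost]
  have hE := B.Erate_pos
  have hη := B.ηdis_pos
  field_simp

end Battery

theorem theorem2 (B : Battery) (R : ℝ) (Φ : ℝ → ℝ)
    (hΦ : ConvexOn ℝ (Set.Icc 0 1) Φ) (hΦ0 : Φ 0 = 0)
    (T : ℕ) (e₀ : ℝ) (d g : ℕ → ℝ) (h : B.Feasible T e₀ d g) :
    Filter.Tendsto (fun J : ℕ => B.pwlCost R Φ J T e₀ d g) Filter.atTop
      (nhds (B.benchmarkCost R Φ T e₀ d g)) := by
  simp only [h.pwlCost_eq, B.benchmarkCost_eq]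
  exact (tendsto_list_sum _ fun δ hδ =>
    tendsto_gridInterpolation hΦ hΦ0 (h.cycleDepths_mem δ hδ)).const_mul R
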